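/- Fix an infinite set $D$ of data values. An attributed word over a finite set $\mathrm{ATT}$ of attributes is a finite or infinite sequence of positions, each of which carries a set of propositions (from a countably infinite supply) and, for each $a\in\mathrm{ATT}$, a value $w@a(i)\in D\cup\{\mathrm{nil}\}$. A $k$-attributed word is one with $|\mathrm{ATT}|=k$. For $d\in D$, the class of $d$ in $w$ is the set of positions at which some attribute has value $d$. Position formulas $\varphi$ and class formulas $\psi$ of the logic $\mathcal L$ are given by $$\varphi ::= p \mid \neg\varphi \mid \varphi\lor\varphi \mid \mathsf X\varphi \mid \mathsf Y\varphi \mid \varphi\,\mathsf U\,\varphi \mid \varphi\,\mathsf S\,\varphi \mid \mathsf C^{\delta}_{@a}\psi \mid \varphi\,\mathsf U_{a}(@a\land\varphi),$$ $$\psi ::= \varphi \mid @b \mid \neg\psi \mid \psi\lor\psi \mid \mathsf X^{=}\psi \mid \mathsf Y^{=}\psi \mid \psi\,\mathsf U^{=}\psi \mid \psi\,\mathsf S^{=}\psi,$$ with $p$ a proposition, $a,b\in\mathrm{ATT}$ and $\delta\in\mathbb Z$. Without the last rule for $\varphi$ this is basic data LTL; the last rule adds the operators $\chi\,\mathsf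 U_a\,\chi$ whose intermediate formula is a position formula and whose target formula has the form $@a\land\varphi$ with $\varphi$ a position formula. Propositions, Boolean connectives and the (non-strict) operators $\mathsf X,\mathsf Y,\mathsf U,\mathsf S$ are interpreted as usual in LTL with past; $\mathsf X\varphi$ and $\mathsf Y\varphi$ require the next and the previous position to exist. $w,i\models \mathsf C^\delta_{@a}\psi$ holds if $d=w@a(i)\neq\mathrm{nil}$, $i+\delta$ is a position of $w$, and $w,i+\delta,d\models\psi$. For a value $d\in D$: $w,i,d\models\varphi$ iff $w,i\models\varphi$; $w,i,d\models @b$ iff $w@b(i)=d$; and $\mathsf X^=,\mathsf Y^=,\mathsf U^=,\mathsf S^=$ are $\mathsf X,\mathsf Y,\mathsf U,\mathsf S$ restricted to the positions in the class of $d$ (the class positions $j>i$, $j<i$, $j\ge i$, $j\le i$, respectively). Finally, $w,i\models\rho\,\mathsf U_a(@a\land\varphi)$ holds if $w@a(i)\neq\mathrm{nil}$ and there is a position $j\ge i$ with $w@a(j)=w@a(i)$, $w,j\models\varphi$, and $w,m\models\rho$ for all $m$ with $i\le m<j$. A non-empty word is a model of $\varphi$ if $\varphi$ holds at its first position. **Theorem.**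 It is undecidable whether a given position formula of $\mathcal L$ (over a finite attribute set given with it) has a finite attributed word as a model, and likewise whether it has an infinite attributed word as a model. For every fixed $k\ge 1$, both problems are undecidable already for formulas over $k$ attributes and $k$-attributed words, in particular for $1$-attributed words; and they remain undecidable if only words are considered in which every attribute has a value (different from $\mathrm{nil}$) at every position. -/

import Mathlib

namespace DataLTL

/-- An attributed word over attributes `Fin k`, with data values from `D`. Its positions are
the natural numbers `i < len`; the word is finite if `len ≠ ⊤` and infinite if `len = ⊤`.
Position `i` carries the set `prop i` of propositions and, for each attribute `a`, the value
`val i a`, where `none` plays the role of `nil` (attribute `a` has no value at `i`).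
The data of `prop` and `val` outside the positions are never consulted. -/
structure AttWord (k : ℕ) (D : Type*) where
  len : ℕ∞
  prop : ℕ → Set ℕ
  val : ℕ → Fin k → Option D

namespace AttWord

variable {k : ℕ} {D : Type*}

/-- `i` is a position of `w`. -/
def IsPos (w : AttWord k D) (i : ℕ) : Prop := (i : ℕ∞) < w.len

/-- `i` belongs to the class of `d`: it is a position at which some attribute has value `d`. -/
def InClass (w : AttWord k D) (d : D) (i : ℕ) : Prop :=
  w.IsPos i ∧ ∃ a, w.val i a = some d

/-- Every attribute has a value at every position. -/
def Complete (w : AttWord k D) : Prop :=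
  ∀ i, w.IsPos i → ∀ a, (w.val i a).isSome

end AttWord

mutual

/-- Position formulas of basic data LTL over the attributes `Fin k` and the propositions `ℕ`,
extended by the formation rule `ρ U_a (@a ∧ φ)` for position formulas `ρ` and `φ`:
`p | ¬φ | φ ∨ φ | X φ | Y φ | φ U φ | φ S φ | C_a^δ ψ | ρ U_a (@a ∧ φ)`. -/
inductive PosFormula (k : ℕ) : Type
  | prop (p : ℕ) : PosFormula k
  | neg (φ : PosFormula k) : PosFormula k
  | or (φ₁ φ₂ : PosFormula k) : PosFormula k
  | next (φ : PosFormula k) : PosFormula k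
  | prev (φ : PosFormula k) : PosFormula k
  | until (φ₁ φ₂ : PosFormula k) : PosFormula k
  | since (φ₁ φ₂ : PosFormula k) : PosFormula k
  /-- `C_a^δ ψ`: freeze the value of `a`, shift by `δ`, and evaluate the class formula `ψ`. -/
  | cls (a : Fin k) (δ : ℤ) (ψ : ClassFormula k) : PosFormula k
  /-- `ρ U_a (@a ∧ φ)`. -/
  | untilAtt (a : Fin k) (ρ φ : PosFormula k) : PosFormula k

/-- Class formulas: `φ | @b | ¬ψ | ψ ∨ ψ | X⁼ ψ | Y⁼ ψ | ψ U⁼ ψ | ψ S⁼ ψ`. -/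
inductive ClassFormula (k : ℕ) : Type
  | pos (φ : PosFormula k) : ClassFormula k
  | att (b : Fin k) : ClassFormula k
  | neg (ψ : ClassFormula k) : ClassFormula k
  | or (ψ₁ ψ₂ : ClassFormula k) : ClassFormula k
  | next (ψ : ClassFormula k) : ClassFormula k
  | prev (ψ : ClassFormula k) : ClassFormula k
  | until (ψ₁ ψ₂ : ClassFormula k) : ClassFormula k
  | since (ψ₁ ψ₂ : ClassFormula k) : ClassFormula k

end

section Semantics

variable {k : ℕ} {D : Type*}

mutual

/-- `w, i ⊨ φ`, for a position `i` of `w`. -/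
def PosFormula.Sat (w : AttWord k D) : PosFormula k → ℕ → Prop
  | .prop p, i => p ∈ w.prop i
  | .neg φ, i => ¬ PosFormula.Sat w φ i
  | .or φ₁ φ₂, i => PosFormula.Sat w φ₁ i ∨ PosFormula.Sat w φ₂ i
  | .next φ, i => w.IsPos (i + 1) ∧ PosFormula.Sat w φ (i + 1)
  | .prev φ, i => ∃ j, j + 1 = i ∧ PosFormula.Sat w φ j
  | .until φ₁ φ₂, i => ∃ j, i ≤ j ∧ w.IsPos j ∧ PosFormula.Sat w φ₂ j ∧
      ∀ m, i ≤ m → m < j → PosFormula.Sat w φ₁ m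
  | .since φ₁ φ₂, i => ∃ j, j ≤ i ∧ PosFormula.Sat w φ₂ j ∧
      ∀ m, j < m → m ≤ i → PosFormula.Sat w φ₁ m
  | .cls a δ ψ, i => ∃ d, w.val i a = some d ∧
      ∃ j : ℕ, (j : ℤ) = (i : ℤ) + δ ∧ w.IsPos j ∧ ClassFormula.Sat w ψ j d
  | .untilAtt a ρ φ, i => ∃ d, w.val i a = some d ∧
      ∃ j, i ≤ j ∧ w.IsPos j ∧ (w.val j a = some d ∧ PosFormula.Sat w φ j) ∧
        ∀ m, i ≤ m → m < j → PosFormula.Sat w ρ m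

/-- `w, i, d ⊨ ψ`, for a position `i` of `w` and a (frozen) data value `d`. -/
def ClassFormula.Sat (w : AttWord k D) : ClassFormula k → ℕ → D → Prop
  | .pos φ, i, _ => PosFormula.Sat w φ i
  | .att b, i, d => w.val i b = some d
  | .neg ψ, i, d => ¬ ClassFormula.Sat w ψ i d
  | .or ψ₁ ψ₂, i, d => ClassFormula.Sat w ψ₁ i d ∨ ClassFormula.Sat w ψ₂ i d
  | .next ψ, i, d => ∃ j, i < j ∧ w.InClass d j ∧
      (∀ m, i < m → m < j → ¬ w.InClass d m) ∧ ClassFormula.Sat w ψ j d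
  | .prev ψ, i, d => ∃ j, j < i ∧ w.InClass d j ∧
      (∀ m, j < m → m < i → ¬ w.InClass d m) ∧ ClassFormula.Sat w ψ j d
  | .until ψ₁ ψ₂, i, d => ∃ j, i ≤ j ∧ w.InClass d j ∧ ClassFormula.Sat w ψ₂ j d ∧
      ∀ m, i ≤ m → m < j → w.InClass d m → ClassFormula.Sat w ψ₁ m d
  | .since ψ₁ ψ₂, i, d => ∃ j, j ≤ i ∧ w.InClass d j ∧ ClassFormula.Sat w ψ₂ j d ∧
      ∀ m, j < m → m ≤ i → w.InClass d m → ClassFormula.Sat w ψ₁ m d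

end

/-- `w ⊨ φ`: the word is non-empty and `φ` holds at its first position. -/
def AttWord.Models (w : AttWord k D) (φ : PosFormula k) : Prop :=
  w.IsPos 0 ∧ φ.Sat w 0

end Semantics

/-- `φ` has a finite model with data values in `D`. -/
def FinSatisfiable (D : Type*) {k : ℕ} (φ : PosFormula k) : Prop :=
  ∃ w : AttWord k D, w.len ≠ ⊤ ∧ w.Models φ

/-- `φ` has an infinite model with data values in `D`. -/
def InfSatisfiable (D : Type*) {k : ℕ} (φ : PosFormula k) : Prop :=
  ∃ w : AttWord k D, w.len = ⊤ ∧ w.Models φ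

/-- `φ` has a finite model in which every attribute has a value at every position. -/
def FinSatisfiableComplete (D : Type*) {k : ℕ} (φ : PosFormula k) : Prop :=
  ∃ w : AttWord k D, w.len ≠ ⊤ ∧ w.Complete ∧ w.Models φ

/-- `φ` has an infinite model in which every attribute has a value at every position. -/
def InfSatisfiableComplete (D : Type*) {k : ℕ} (φ : PosFormula k) : Prop :=
  ∃ w : AttWord k D, w.len = ⊤ ∧ w.Complete ∧ w.Models φ

section Coding

variable {k : ℕ}

mutual

/-- Gödel numbering of position formulas. -/
def PosFormula.code : PosFormula k → ℕ
  | .prop p => Nat.pair 0 p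
  | .neg φ => Nat.pair 1 φ.code
  | .or φ₁ φ₂ => Nat.pair 2 (Nat.pair φ₁.code φ₂.code)
  | .next φ => Nat.pair 3 φ.code
  | .prev φ => Nat.pair 4 φ.code
  | .until φ₁ φ₂ => Nat.pair 5 (Nat.pair φ₁.code φ₂.code)
  | .since φ₁ φ₂ => Nat.pair 6 (Nat.pair φ₁.code φ₂.code)
  | .cls a δ ψ => Nat.pair 7 (Nat.pair a (Nat.pair (Encodable.encode δ) ψ.code))
  | .untilAtt a ρ φ => Nat.pair 8 (Nat.pair a (Nat.pair ρ.code φ.code))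

/-- Gödel numbering of class formulas. -/
def ClassFormula.code : ClassFormula k → ℕ
  | .pos φ => Nat.pair 0 φ.code
  | .att b => Nat.pair 1 b
  | .neg ψ => Nat.pair 2 ψ.code
  | .or ψ₁ ψ₂ => Nat.pair 3 (Nat.pair ψ₁.code ψ₂.code)
  | .next ψ => Nat.pair 4 ψ.code
  | .prev ψ => Nat.pair 5 ψ.code
  | .until ψ₁ ψ₂ => Nat.pair 6 (Nat.pair ψ₁.code ψ₂.code)
  | .since ψ₁ ψ₂ => Nat.pair 7 (Nat.pair ψ₁.code ψ₂.code)

end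

mutual

theorem PosFormula.code_inj : ∀ φ φ' : PosFormula k, φ.code = φ'.code → φ = φ'
  | .prop p, φ', h => by
      cases φ' <;> simp_all [PosFormula.code, Nat.pair_eq_pair]
  | .neg φ, φ', h => by
      have ih := PosFormula.code_inj φ
      cases φ' <;> simp only [PosFormula.code, Nat.pair_eq_pair] at h <;> grind
  | .or φ₁ φ₂, φ', h => by
      have ih₁ := PosFormula.code_inj φ₁
      have ih₂ := PosFormula.code_inj φ₂
      cases φ' <;> simp only [PosFormula.code, Nat.pair_eq_pair] at h <;> grind
  | .next φ, φ', h => by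
      have ih := PosFormula.code_inj φ
      cases φ' <;> simp only [PosFormula.code, Nat.pair_eq_pair] at h <;> grind
  | .prev φ, φ', h => by
      have ih := PosFormula.code_inj φ
      cases φ' <;> simp only [PosFormula.code, Nat.pair_eq_pair] at h <;> grind
  | .until φ₁ φ₂, φ', h => by
      have ih₁ := PosFormula.code_inj φ₁
      have ih₂ := PosFormula.code_inj φ₂
      cases φ' <;> simp only [PosFormula.code, Nat.pair_eq_pair] at h <;> grind
  | .since φ₁ φ₂, φ', h => by
      have ih₁ := PosFormula.code_inj φ₁
      have ih₂ := PosFormula.code_inj φ₂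
      cases φ' <;> simp only [PosFormula.code, Nat.pair_eq_pair] at h <;> grind
  | .cls a δ ψ, φ', h => by
      have ih := ClassFormula.code_inj ψ
      cases φ' <;>
        simp only [PosFormula.code, Nat.pair_eq_pair, Fin.val_inj, Encodable.encode_inj] at h <;>
        grind
  | .untilAtt a ρ φ, φ', h => by
      have ih₁ := PosFormula.code_inj ρ
      have ih₂ := PosFormula.code_inj φ
      cases φ' <;> simp only [PosFormula.code, Nat.pair_eq_pair, Fin.val_inj] at h <;> grind

theorem ClassFormula.code_inj : ∀ ψ ψ' : ClassFormula k, ψ.code = ψ'.code → ψ = ψ'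
  | .pos φ, ψ', h => by
      have ih := PosFormula.code_inj φ
      cases ψ' <;> simp only [ClassFormula.code, Nat.pair_eq_pair] at h <;> grind
  | .att b, ψ', h => by
      cases ψ' <;> simp only [ClassFormula.code, Nat.pair_eq_pair, Fin.val_inj] at h <;> grind
  | .neg ψ, ψ', h => by
      have ih := ClassFormula.code_inj ψ
      cases ψ' <;> simp only [ClassFormula.code, Nat.pair_eq_pair] at h <;> grind
  | .or ψ₁ ψ₂, ψ', h => by
      have ih₁ := ClassFormula.code_inj ψ₁
      have ih₂ := ClassFormula.code_inj ψ₂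
      cases ψ' <;> simp only [ClassFormula.code, Nat.pair_eq_pair] at h <;> grind
  | .next ψ, ψ', h => by
      have ih := ClassFormula.code_inj ψ
      cases ψ' <;> simp only [ClassFormula.code, Nat.pair_eq_pair] at h <;> grind
  | .prev ψ, ψ', h => by
      have ih := ClassFormula.code_inj ψ
      cases ψ' <;> simp only [ClassFormula.code, Nat.pair_eq_pair] at h <;> grind
  | .until ψ₁ ψ₂, ψ', h => by
      have ih₁ := ClassFormula.code_inj ψ₁
      have ih₂ := ClassFormula.code_inj ψ₂
      cases ψ' <;> simp only [ClassFormula.code, Nat.pair_eq_pair] at h <;> grind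
  | .since ψ₁ ψ₂, ψ', h => by
      have ih₁ := ClassFormula.code_inj ψ₁
      have ih₂ := ClassFormula.code_inj ψ₂
      cases ψ' <;> simp only [ClassFormula.code, Nat.pair_eq_pair] at h <;> grind

end

/-- The Gödel numbering is injective, so a formula can be recovered from its code. -/
theorem PosFormula.code_injective : Function.Injective (PosFormula.code (k := k)) :=
  fun φ φ' h => PosFormula.code_inj φ φ' h

end Coding

/-- Code of a formula together with the number of attributes it is built over. -/
def codeAny (x : Σ k : ℕ, PosFormula k) : ℕ := Nat.pair x.1 x.2.code

theorem codeAny_injective : Function.Injective codeAny := by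
  rintro ⟨k, φ⟩ ⟨k', φ'⟩ h
  obtain ⟨h1, h2⟩ := Nat.pair_eq_pair.1 h
  dsimp only at h1 h2
  subst h1
  rw [PosFormula.code_injective h2]

/-- The decision problem with instances `x : α`, presented through their codes, and with
yes-instances `P` is undecidable: no computable function answers it correctly. -/
def Undecidable {α : Type*} (code : α → ℕ) (P : α → Prop) : Prop :=
  ¬ ∃ f : ℕ → Bool, Computable f ∧ ∀ x, f (code x) = true ↔ P x

end DataLTL

/-!
The halting problem of counter automata with zero tests reduces to each of the satisfiability
problems.

A run of a counter automaton is written down as a word whose positions carry the transitions, and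
in which the increments of a counter are matched with its decrements: an increment and the
decrement that undoes it have the same data value, and no other increment or decrement of that
counter has it. Basic data LTL can say that increments of the same counter have different values,
that decrements have different values, and that each decrement has the value of an earlier
increment; so no counter drops below zero. A counter is zero at a zero test if every earlier
increment has been matched with a decrement before the test, and this is what the additional
operator expresses: at an increment of `c` that is followed by a zero test of `c`, the formula
`(no zero test of c) U_a (@a ∧ decrement of c)` holds (`LabelSystem.dataConstraint`). Such values
exist exactly if the operations can be executed (`Matching.exists_executable`,
`Executable.exists_matching`): the `n`-th increment of a counter can be matched with its `n`-th
decrement. A single attribute suffices, and positions which are neither increments nor decrements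
may have any value. The formula imposes its conditions only at the positions before the first halt
label, so one formula serves for finite and for infinite words.

One fixed automaton is used, and the input `n` enters as the number of increments of counter `0`
at the beginning of the run. The formula for `n` is then a fixed formula together with a nesting
of `n` operators `X`, which makes the reduction computable.

That some counter automaton has an undecidable halting problem is shown from the halting problem
for partial recursive functions. Halting of a program with number `n` means that a primitive
recursive function `f` satisfies `f (n, k) = 0` for some `k`. The automaton guesses `k`, runs a loop
program for `f`, and tests the result for zero (`exists_counterAutomaton_undecidable`).
-/

namespace DataLTL

open Function (update)

/-! ### Loop programs -/

/-- Programs over registers indexed by `ℕ`. In `loop r p` the body `p` is run as long as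
register `r` is nonzero, and `r` is decremented before each run of the body. -/
inductive Prog : Type
  | skip : Prog
  | inc (r : ℕ) : Prog
  | seq (p q : Prog) : Prog
  | loop (r : ℕ) (p : Prog) : Prog

namespace Prog

/-- Big-step semantics: `Run p s t` says that `p`, started with register contents `s`,
terminates with contents `t`. -/
inductive Run : Prog → (ℕ → ℕ) → (ℕ → ℕ) → Prop
  | skip (s) : Run skip s s
  | inc (r s) : Run (inc r) s (update s r (s r + 1))
  | seq {p q s t u} : Run p s t → Run q t u → Run (seq p q) s u
  | loop_zero {r p s} : s r = 0 → Run (loop r p) s s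
  | loop_succ {r p s t u c} : s r = c + 1 → Run p (update s r c) t → Run (loop r p) t u →
      Run (loop r p) s u

namespace Run

theorem of_eq {p : Prog} {s t u : ℕ → ℕ} (h : Run p s t) (e : t = u) : Run p s u := e ▸ h

/-- Loop programs are deterministic. -/
theorem det {p : Prog} {s t u : ℕ → ℕ} (h : Run p s t) (h' : Run p s u) : t = u := by
  induction h generalizing u with
  | skip => cases h'; rfl
  | inc => cases h'; rfl
  | seq _ _ ih₁ ih₂ =>
    cases h' with
    | seq a b => exact ih₂ (ih₁ a ▸ b)
  | loop_zero h =>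
    cases h' with
    | loop_zero => rfl
    | loop_succ h₁ => omega
  | loop_succ h _ _ ih₁ ih₂ =>
    cases h' with
    | loop_zero h₁ => omega
    | loop_succ h₁ a b =>
      obtain rfl : _ = _ := Nat.succ.inj (h.symm.trans h₁)
      exact ih₂ (ih₁ a ▸ b)

end Run

/-- Sets `r` to zero. -/
def clear (r : ℕ) : Prog := loop r skip

theorem run_clear (r : ℕ) (s : ℕ → ℕ) : Run (clear r) s (update s r 0) := by
  generalize hc : s r = c
  induction c generalizing s with
  | zero => exact (Run.loop_zero hc).of_eq (by simp [← hc])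
  | succ c ih =>
    exact Run.loop_succ hc (.skip _) ((ih _ (by simp)).of_eq (by simp))

/-- Adds `a` to `b`, setting `a` to zero. -/
def move (a b : ℕ) : Prog := loop a (inc b)

theorem run_move {a b : ℕ} (hab : a ≠ b) (s : ℕ → ℕ) :
    Run (move a b) s (update (update s a 0) b (s b + s a)) := by
  generalize hc : s a = c
  induction c generalizing s with
  | zero =>
    refine (Run.loop_zero hc).of_eq ?_
    funext j; simp only [Function.update_apply]; grind
  | succ c ih =>
    refine Run.loop_succ hc (.inc _ _) ((ih _ ?_).of_eq ?_)
    · simp [Function.update_apply, hab]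
    · funext j; simp only [Function.update_apply]; grind

/-- Adds `a` to both `b` and `c`, setting `a` to zero. -/
def moveTwo (a b c : ℕ) : Prog := loop a (seq (inc b) (inc c))

theorem run_moveTwo {a b c : ℕ} (hab : a ≠ b) (hac : a ≠ c) (hbc : b ≠ c) (s : ℕ → ℕ) :
    Run (moveTwo a b c) s (update (update (update s a 0) b (s b + s a)) c (s c + s a)) := by
  generalize hn : s a = n
  induction n generalizing s with
  | zero =>
    refine (Run.loop_zero hn).of_eq ?_
    funext j; simp only [Function.update_apply]; grind
  | succ n ih =>
    refine Run.loop_succ hn (.seq (.inc _ _) (.inc _ _)) ((ih _ ?_).of_eq ?_)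
    · simp [Function.update_apply, hab, hac]
    · funext j; simp only [Function.update_apply]; grind

/-- Copies `a` to `b`, using `b + 1` as auxiliary register. -/
def copy (a b : ℕ) : Prog := seq (moveTwo a b (b + 1)) (move (b + 1) a)

theorem run_copy {a b : ℕ} (hab : a < b) (s : ℕ → ℕ) (hb : s b = 0) (hb' : s (b + 1) = 0) :
    Run (copy a b) s (update s b (s a)) := by
  refine (Run.seq (run_moveTwo (by omega) (by omega) (by omega) s)
    (run_move (by omega) _)).of_eq ?_
  funext j; simp only [Function.update_apply]; grind

/-- Sets the registers `b, …, b + k - 1` to zero. -/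
def clearBlock (b : ℕ) : ℕ → Prog
  | 0 => skip
  | k + 1 => seq (clearBlock b k) (clear (b + k))

theorem run_clearBlock (b k : ℕ) (s : ℕ → ℕ) :
    Run (clearBlock b k) s (fun j => if b ≤ j ∧ j < b + k then 0 else s j) := by
  induction k with
  | zero => exact (Run.skip s).of_eq (by funext j; grind)
  | succ k ih =>
    refine (Run.seq ih (run_clear _ _)).of_eq ?_
    funext j; simp only [Function.update_apply]; grind

end Prog

open Prog

/-- For any choice of argument registers below `b`, some program writes the value of `f` at
their contents into register `b`, provided that all registers from `b` on are zero before.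
All other registers have the same contents afterwards, so those above `b` are free again. -/
def LoopComputable {n : ℕ} (f : List.Vector ℕ n → ℕ) : Prop :=
  ∀ (r : Fin n → ℕ) (b : ℕ), (∀ i, r i < b) → ∃ p : Prog, ∀ s : ℕ → ℕ, (∀ j, b ≤ j → s j = 0) →
    p.Run s (update s b (f (.ofFn fun i => s (r i))))

namespace LoopComputable

theorem comp {m n : ℕ} {f : List.Vector ℕ n → ℕ} {g : Fin n → List.Vector ℕ m → ℕ}
    (hf : LoopComputable f) (hg : ∀ i, LoopComputable (g i)) :
    LoopComputable fun v => f (.ofFn fun i => g i v) := by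
  intro r b hr
  -- the values of the first `k` functions `g i` are stored in the registers from `b` on
  have block : ∀ k, k ≤ n → ∃ p : Prog, ∀ s : ℕ → ℕ, (∀ j, b ≤ j → s j = 0) →
      p.Run s fun j => if h : b ≤ j ∧ j < b + k ∧ j - b < n then
        g ⟨j - b, h.2.2⟩ (.ofFn fun i => s (r i)) else s j := by
    intro k
    induction k with
    | zero =>
      intro _
      exact ⟨skip, fun s _ => (Run.skip s).of_eq (by funext j; grind)⟩
    | succ k ih =>
      intro hk
      obtain ⟨p, hp⟩ := ih (by omega)
      obtain ⟨q, hq⟩ := hg ⟨k, hk⟩ r (b + k) (fun i => (hr i).trans_le (by omega))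
      refine ⟨seq p q, fun s hs => (Run.seq (hp s hs) (hq _ ?_)).of_eq ?_⟩
      · grind
      · have e : ∀ i, ¬ b ≤ r i := fun i => by have := hr i; omega
        funext j
        simp only [Function.update_apply, e, false_and, dite_false]
        by_cases hj : j = b + k
        · subst hj; simp; omega
        · grind
  obtain ⟨p, hp⟩ := block n le_rfl
  obtain ⟨q, hq⟩ := hf (fun i => b + i) (b + n + 1) (fun i => by omega)
  refine ⟨seq p (seq q (seq (clearBlock b n) (move (b + n + 1) b))), fun s hs => ?_⟩
  have hp := hp s hs
  set t : ℕ → ℕ := fun j => if h : b ≤ j ∧ j < b + n ∧ j - b < n then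
    g ⟨j - b, h.2.2⟩ (.ofFn fun i => s (r i)) else s j with ht
  have ht_block : (fun i : Fin n => t (b + i)) = fun i => g i (.ofFn fun i => s (r i)) := by
    funext i; simp [ht]
  have ht_zero : ∀ j, b + n ≤ j → t j = 0 := by grind
  have ht_eq : ∀ j, j < b → t j = s j := by grind
  have hq := hq t fun j hj => ht_zero j (by omega)
  rw [ht_block] at hq
  refine (Run.seq hp (Run.seq hq (Run.seq (run_clearBlock _ _ _)
    (run_move (by omega) _)))).of_eq ?_
  funext j
  have := hs j
  have := ht_zero b
  clear_value t
  simp only [Function.update_apply]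
  grind

theorem prec {n : ℕ} {f : List.Vector ℕ n → ℕ} {g : List.Vector ℕ (n + 2) → ℕ}
    (hf : LoopComputable f) (hg : LoopComputable g) :
    LoopComputable fun v : List.Vector ℕ (n + 1) =>
      v.head.rec (f v.tail) fun y IH => g (y ::ᵥ IH ::ᵥ v.tail) := by
  intro r b hr
  obtain ⟨p, hp⟩ := hf (fun i => r i.succ) b (fun i => hr _)
  obtain ⟨q, hq⟩ := hg (Fin.cons (b + 2) (Fin.cons b fun i => r i.succ)) (b + 3) (by
    intro i
    refine Fin.cases ?_ (fun i => Fin.cases ?_ (fun i => ?_) i) i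
    · simp
    · simp
    · simpa using (hr _).trans (by omega : b < b + 3))
  refine ⟨seq p (seq (copy (r 0) (b + 1)) (seq (loop (b + 1) (seq q (seq (clear b)
    (seq (move (b + 3) b) (inc (b + 2)))))) (clear (b + 2)))), fun s hs => ?_⟩
  set v : List.Vector ℕ n := .ofFn fun i => s (r i.succ) with hv
  set F : ℕ → ℕ := fun y => y.rec (f v) fun y IH => g (y ::ᵥ IH ::ᵥ v) with hF
  -- `b` holds the accumulator, `b + 1` the rounds to go, `b + 2` the rounds done
  have loop_run : ∀ c y, Run (loop (b + 1) (seq q (seq (clear b)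
      (seq (move (b + 3) b) (inc (b + 2))))))
      (update (update (update s b (F y)) (b + 1) c) (b + 2) y)
      (update (update (update s b (F (y + c))) (b + 1) 0) (b + 2) (y + c)) := by
    intro c
    induction c with
    | zero => exact fun y => Run.loop_zero (by simp)
    | succ c ih =>
      intro y
      have hgv : ∀ t : ℕ → ℕ, (∀ i, t (r i) = s (r i)) → t b = F y → t (b + 2) = y →
          g (.ofFn fun i => t ((Fin.cons (b + 2) (Fin.cons b fun i => r i.succ) :
            Fin (n + 2) → ℕ) i)) = F (y + 1) := by
        intro t h₁ h₂ h₃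
        change _ = g (y ::ᵥ F y ::ᵥ v)
        congr 1
        rw [List.Vector.ofFn, List.Vector.ofFn]
        simp [h₁, h₂, h₃, hv]
      refine Run.loop_succ (c := c) (by simp) (Run.seq (hq _ ?_) (Run.seq (run_clear _ _)
        (Run.seq (run_move (by omega) _) (Run.inc _ _)))) ?_
      · intro j hj
        simp only [Function.update_apply]
        grind
      · rw [hgv]
        · rw [show y + (c + 1) = y + 1 + c by omega]
          convert ih (y + 1) using 1
          have := hs (b + 3)
          funext j; simp only [Function.update_apply]; grind
        · intro i
          have := hr i
          simp only [Function.update_apply]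
          grind
        · simp only [Function.update_apply]
          grind
        · simp only [Function.update_apply]
          grind
  have h0 := hr 0
  have e : (List.Vector.ofFn fun i => s (r i)) = s (r 0) ::ᵥ v := rfl
  refine (Run.seq (hp s hs) (Run.seq (run_copy (by omega) _ ?_ ?_)
    (Run.seq (t := update (update (update s b (F (s (r 0)))) (b + 1) 0) (b + 2) (s (r 0))) ?_
      (run_clear _ _)))).of_eq ?_
  · simp [hs]
  · have := hs (b + 1 + 1)
    simp only [Function.update_apply]; grind
  · have := loop_run (s (r 0)) 0
    rw [Nat.zero_add] at this
    convert this using 1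
    have := hs (b + 2)
    funext j; simp only [Function.update_apply]
    have hF0 : F 0 = f v := rfl
    clear_value F
    grind
  · have := hs (b + 1)
    have := hs (b + 2)
    rw [e]
    funext j; simp only [Function.update_apply, List.Vector.head_cons, List.Vector.tail_cons, hF]
    grind

/-- Primitive recursive functions are computed by loop programs. -/
theorem of_primrec {n : ℕ} {f : List.Vector ℕ n → ℕ} (hf : Nat.Primrec' f) :
    LoopComputable f := by
  induction hf with
  | zero =>
    intro r b _
    refine ⟨skip, fun s hs => (Run.skip s).of_eq ?_⟩
    exact (Function.update_eq_self_iff.2 (hs b le_rfl).symm).symm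
  | succ =>
    intro r b hr
    refine ⟨seq (copy (r 0) b) (inc b), fun s hs =>
      (Run.seq (run_copy (hr 0) s (hs _ le_rfl) (hs _ (by omega))) (Run.inc _ _)).of_eq ?_⟩
    simp
  | get i =>
    intro r b hr
    refine ⟨copy (r i) b, fun s hs =>
      (run_copy (hr i) s (hs _ le_rfl) (hs _ (by omega))).of_eq ?_⟩
    simp
  | comp g _ _ hf hg => exact hf.comp hg
  | prec _ _ hf hg => exact hf.prec hg

end LoopComputable

/-! ### Counter automata -/

/-- Operations of a counter automaton. The decrement blocks on a counter with value zero, and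
`zero r` blocks on a counter with nonzero value. -/
inductive Op : Type
  | nop : Op
  | inc (r : ℕ) : Op
  | dec (r : ℕ) : Op
  | zero (r : ℕ) : Op

/-- The effect of an operation on the counter values. -/
def Op.Step : Op → (ℕ → ℕ) → (ℕ → ℕ) → Prop
  | nop, s, t => t = s
  | inc r, s, t => t = update s r (s r + 1)
  | dec r, s, t => s = update t r (t r + 1)
  | zero r, s, t => s r = 0 ∧ t = s

/-- A nondeterministic counter automaton with zero tests. Only the states that occur in the list
of transitions matter, so that the automaton is finite whatever the type of states. -/
structure CounterAutomaton (σ : Type) where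
  trans : List (σ × Op × σ)
  init : σ
  final : σ

namespace CounterAutomaton

variable {σ τ : Type}

/-- One step between configurations, which are pairs of a state and counter values. -/
def Step (A : CounterAutomaton σ) (c d : σ × (ℕ → ℕ)) : Prop :=
  ∃ o, (c.1, o, d.1) ∈ A.trans ∧ o.Step c.2 d.2

/-- Reachability between configurations. -/
def Reach (A : CounterAutomaton σ) : σ × (ℕ → ℕ) → σ × (ℕ → ℕ) → Prop :=
  Relation.ReflTransGen A.Step

theorem Reach.cons {A : CounterAutomaton σ} {q q' : σ} {o : Op} {s t : ℕ → ℕ}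
    {d : σ × (ℕ → ℕ)} (hm : (q, o, q') ∈ A.trans) (ho : o.Step s t) (h : A.Reach (q', t) d) :
    A.Reach (q, s) d :=
  .head ⟨o, hm, ho⟩ h

theorem Reach.lift {A : CounterAutomaton σ} {B : CounterAutomaton τ} (f : σ → τ)
    (hf : ∀ x ∈ A.trans, (f x.1, x.2.1, f x.2.2) ∈ B.trans) {c d : σ × (ℕ → ℕ)}
    (h : A.Reach c d) : B.Reach (f c.1, c.2) (f d.1, d.2) := by
  induction h with
  | refl => exact .refl
  | tail _ h ih =>
    obtain ⟨o, hm, ho⟩ := h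
    exact ih.tail ⟨o, hf _ hm, ho⟩

/-- Some run from the initial to the final state transforms the counter values `s` into `t`. -/
def Realizes (A : CounterAutomaton σ) (s t : ℕ → ℕ) : Prop :=
  A.Reach (A.init, s) (A.final, t)

/-- The automaton with a single transition, which carries `o`. -/
@[simps]
def single (o : Op) : CounterAutomaton Bool where
  trans := [(false, o, true)]
  init := false
  final := true

theorem realizes_single {o : Op} {s t : ℕ → ℕ} : (single o).Realizes s t ↔ o.Step s t := by
  constructor
  · intro h
    rcases Relation.ReflTransGen.cases_head h with h | ⟨⟨q, u⟩, ⟨o', h₁, h₂⟩, h⟩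
    · simp [single] at h
    · simp only [single_trans, List.mem_singleton, Prod.mk.injEq] at h₁
      obtain ⟨-, rfl, rfl⟩ := h₁
      rcases Relation.ReflTransGen.cases_head h with h | ⟨⟨q, v⟩, ⟨o'', h₃, -⟩, -⟩
      · have : u = t := congrArg Prod.snd h
        exact this ▸ h₂
      · simp [single] at h₃
  · exact fun h => Relation.ReflTransGen.single ⟨o, by simp [single], h⟩

/-- The automaton that increments `r` an arbitrary number of times. -/
@[simps]
def guess (r : ℕ) : CounterAutomaton Unit where
  trans := [((), .inc r, ())]
  init := ()
  final := ()

theorem realizes_guess {r : ℕ} {s t : ℕ → ℕ} :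
    (guess r).Realizes s t ↔ ∃ k, t = update s r (s r + k) := by
  constructor
  · intro h
    have : ∀ c, (guess r).Reach c ((), t) → ∃ k, t = update c.2 r (c.2 r + k) := by
      intro c hc
      induction hc using Relation.ReflTransGen.head_induction_on with
      | refl => exact ⟨0, by simp⟩
      | head h _ ih =>
        obtain ⟨o, h₁, h₂⟩ := h
        obtain ⟨k, hk⟩ := ih
        obtain rfl : o = .inc r := by simpa [guess] using h₁
        refine ⟨k + 1, ?_⟩
        rw [hk, h₂]
        simp [add_assoc, add_comm]
    exact this _ h
  · rintro ⟨k, rfl⟩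
    induction k with
    | zero => simpa using! (Relation.ReflTransGen.refl : (guess r).Reach (_, s) _)
    | succ k ih =>
      refine ih.tail ⟨.inc r, by simp [guess], ?_⟩
      simp [Op.Step, add_assoc]

/-- Sequential composition. -/
@[simps]
def seq (A : CounterAutomaton σ) (B : CounterAutomaton τ) : CounterAutomaton (σ ⊕ τ) where
  trans := A.trans.map (fun x => (.inl x.1, x.2.1, .inl x.2.2)) ++
    (.inl A.final, .nop, .inr B.init) :: B.trans.map fun x => (.inr x.1, x.2.1, .inr x.2.2)
  init := .inl A.init
  final := .inr B.final

theorem realizes_seq {A : CounterAutomaton σ} {B : CounterAutomaton τ} {s u : ℕ → ℕ} :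
    (A.seq B).Realizes s u ↔ ∃ t, A.Realizes s t ∧ B.Realizes t u := by
  constructor
  · intro h
    have : ∀ c, (A.seq B).Reach c (.inr B.final, u) →
        (∀ q, c.1 = .inl q → ∃ t, A.Reach (q, c.2) (A.final, t) ∧ B.Realizes t u) ∧
        (∀ q, c.1 = .inr q → B.Reach (q, c.2) (B.final, u)) := by
      intro c hc
      induction hc using Relation.ReflTransGen.head_induction_on with
      | refl =>
        refine ⟨by simp, fun q hq => ?_⟩
        cases hq
        exact .refl
      | @head c d h _ ih =>
        obtain ⟨o, h₁, h₂⟩ := h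
        obtain ⟨c, s⟩ := c
        obtain ⟨d, s'⟩ := d
        simp only [seq_trans, List.mem_append, List.mem_map, List.mem_cons, Prod.mk.injEq] at h₁
        rcases h₁ with ⟨⟨q, o', q'⟩, hm, rfl, rfl, rfl⟩ | ⟨rfl, rfl, rfl⟩ |
          ⟨⟨q, o', q'⟩, hm, rfl, rfl, rfl⟩
        · refine ⟨fun p hp => ?_, by simp⟩
          cases hp
          obtain ⟨t, h₃, h₄⟩ := ih.1 _ rfl
          exact ⟨t, .head ⟨_, hm, h₂⟩ h₃, h₄⟩
        · refine ⟨fun p hp => ?_, by simp⟩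
          cases hp
          obtain rfl : s' = s := h₂
          exact ⟨_, .refl, ih.2 _ rfl⟩
        · refine ⟨by simp, fun p hp => ?_⟩
          cases hp
          exact .head ⟨_, hm, h₂⟩ (ih.2 _ rfl)
    exact (this _ h).1 _ rfl
  · rintro ⟨t, h₁, h₂⟩
    have h₁ : (A.seq B).Reach (.inl A.init, s) (.inl A.final, t) :=
      Reach.lift Sum.inl (fun x hx => List.mem_append_left _ (List.mem_map.2 ⟨x, hx, rfl⟩)) h₁
    have h₂ : (A.seq B).Reach (.inr B.init, t) (.inr B.final, u) :=
      Reach.lift Sum.inr (fun x hx => List.mem_append_right _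
        (List.mem_cons_of_mem _ (List.mem_map.2 ⟨x, hx, rfl⟩))) h₂
    exact h₁.trans (Reach.cons (o := .nop) (by simp) rfl h₂)

/-- Runs `A` as long as `r` is nonzero, after decrementing `r` each time. The states added are
the head of the loop, `false`, and the exit, `true`. -/
@[simps]
def loop (r : ℕ) (A : CounterAutomaton σ) : CounterAutomaton (σ ⊕ Bool) where
  trans := A.trans.map (fun x => (.inl x.1, x.2.1, .inl x.2.2)) ++
    [(.inr false, .dec r, .inl A.init), (.inl A.final, .nop, .inr false),
      (.inr false, .zero r, .inr true)]
  init := .inr false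
  final := .inr true

theorem realizes_loop {r : ℕ} {p : Prog} {A : CounterAutomaton σ}
    (hA : ∀ s t, A.Realizes s t ↔ p.Run s t) {s u : ℕ → ℕ} :
    (A.loop r).Realizes s u ↔ (Prog.loop r p).Run s u := by
  constructor
  · intro h
    have : ∀ c, (A.loop r).Reach c (.inr true, u) →
        (∀ q, c.1 = .inl q → ∃ t, A.Reach (q, c.2) (A.final, t) ∧ (Prog.loop r p).Run t u) ∧
        (c.1 = .inr false → (Prog.loop r p).Run c.2 u) ∧ (c.1 = .inr true → c.2 = u) := by
      intro c hc
      induction hc using Relation.ReflTransGen.head_induction_on with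
      | refl => simp
      | @head c d h _ ih =>
        obtain ⟨o, h₁, h₂⟩ := h
        obtain ⟨c, s⟩ := c
        obtain ⟨d, s'⟩ := d
        simp only [loop_trans, List.mem_append, List.mem_map, List.mem_cons, List.not_mem_nil,
          Prod.mk.injEq, or_false] at h₁
        rcases h₁ with ⟨⟨q, o', q'⟩, hm, rfl, rfl, rfl⟩ | ⟨rfl, rfl, rfl⟩ | ⟨rfl, rfl, rfl⟩ |
          ⟨rfl, rfl, rfl⟩
        · refine ⟨fun p hp => ?_, by simp, by simp⟩
          cases hp
          obtain ⟨t, h₃, h₄⟩ := ih.1 _ rfl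
          exact ⟨t, .head ⟨_, hm, h₂⟩ h₃, h₄⟩
        · refine ⟨by simp, fun _ => ?_, by simp⟩
          obtain ⟨t, h₃, h₄⟩ := ih.1 _ rfl
          have h₂ : s = update s' r (s' r + 1) := h₂
          refine .loop_succ (c := s' r) (by simp [h₂]) ((hA _ _).1 ?_) h₄
          rw [h₂, Function.update_idem, Function.update_eq_self]
          exact h₃
        · refine ⟨fun p hp => ?_, by simp, by simp⟩
          cases hp
          obtain rfl : s' = s := h₂
          exact ⟨_, .refl, ih.2.1 rfl⟩
        · refine ⟨by simp, fun _ => ?_, by simp⟩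
          obtain ⟨h₂, rfl⟩ := h₂
          exact ih.2.2 rfl ▸ .loop_zero h₂
    exact (this _ h).2.1 rfl
  · intro h
    generalize hl : Prog.loop r p = l at h
    induction h with
    | skip | inc | seq => simp at hl
    | loop_zero h =>
      cases hl
      exact Relation.ReflTransGen.single ⟨.zero r, by simp [loop], h, rfl⟩
    | @loop_succ r' p' s t u c h h₁ _ _ ih =>
      cases hl
      have h₁ : (A.loop r).Reach (.inl A.init, update s r c) (.inl A.final, t) :=
        Reach.lift Sum.inl (fun x hx => List.mem_append_left _ (List.mem_map.2 ⟨x, hx, rfl⟩))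
          ((hA _ _).2 h₁)
      refine Reach.cons (o := .dec r) (t := update s r c) (by simp) ?_
        (h₁.trans (Reach.cons (o := .nop) (by simp) rfl (ih rfl)))
      simp [Op.Step, ← h]

/-- Loop programs are realized by counter automata. -/
theorem exists_realizes_iff_run (p : Prog) :
    ∃ (σ : Type) (A : CounterAutomaton σ), ∀ s t, A.Realizes s t ↔ p.Run s t := by
  induction p with
  | skip =>
    refine ⟨_, single .nop, fun s t => realizes_single.trans ⟨?_, ?_⟩⟩
    · rintro rfl; exact .skip _
    · rintro ⟨⟩; rfl
  | inc r =>
    refine ⟨_, single (.inc r), fun s t => realizes_single.trans ⟨?_, ?_⟩⟩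
    · rintro rfl; exact .inc _ _
    · rintro ⟨⟩; rfl
  | seq p q hp hq =>
    obtain ⟨_, A, hA⟩ := hp
    obtain ⟨_, B, hB⟩ := hq
    refine ⟨_, A.seq B, fun s u => realizes_seq.trans ⟨?_, ?_⟩⟩
    · rintro ⟨t, h₁, h₂⟩; exact .seq ((hA _ _).1 h₁) ((hB _ _).1 h₂)
    · rintro ⟨⟩
      exact ⟨_, (hA _ _).2 ‹_›, (hB _ _).2 ‹_›⟩
  | loop r p hp =>
    obtain ⟨_, A, hA⟩ := hp
    exact ⟨_, A.loop r, fun s t => realizes_loop hA⟩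

/-- Projections of primitive recursive relations are accepted by counter automata: the automaton
guesses the witness `k` and then checks it. -/
theorem exists_realizes_iff_exists {f : List.Vector ℕ 2 → ℕ} (hf : Nat.Primrec' f) :
    ∃ (σ : Type) (A : CounterAutomaton σ), ∀ n, (∃ t, A.Realizes (update 0 0 n) t) ↔
      ∃ k, f (n ::ᵥ k ::ᵥ .nil) = 0 := by
  obtain ⟨p, hp⟩ := LoopComputable.of_primrec hf (fun i => (i : ℕ)) 2 (fun i => i.2)
  obtain ⟨_, A, hA⟩ := exists_realizes_iff_run p
  have run : ∀ n k : ℕ, p.Run (update (update 0 0 n) 1 k)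
      (update (update (update 0 0 n) 1 k) 2 (f (n ::ᵥ k ::ᵥ .nil))) := fun n k =>
    hp (update (update 0 0 n) 1 k) fun j hj => by simp [Function.update_apply]; grind
  refine ⟨_, (guess 1).seq (A.seq (single (.zero 2))), fun n => ?_⟩
  simp only [realizes_seq, realizes_guess, realizes_single, hA, Op.Step]
  constructor
  · rintro ⟨_, _, ⟨k, rfl⟩, t, h₁, h₂, -⟩
    have h₁ : p.Run (update (update 0 0 n) 1 k) t := by simpa using h₁
    refine ⟨k, ?_⟩
    rw [h₁.det (run n k)] at h₂
    simpa using h₂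
  · rintro ⟨k, hk⟩
    exact ⟨_, _, ⟨k, rfl⟩, _, by simpa using run n k, by simp [hk], rfl⟩

end CounterAutomaton

/-- Some counter automaton has an undecidable halting problem with respect to the initial value
of counter `0`. -/
theorem exists_counterAutomaton_undecidable : ∃ (σ : Type) (A : CounterAutomaton σ),
    ¬ ComputablePred fun n => ∃ t, A.Realizes (update 0 0 n) t := by
  -- `f (n, k)` is `0` iff the program with number `n` halts on input `0` within resources `k`
  let f : List.Vector ℕ 2 → ℕ := fun v =>
    if ((Denumerable.ofNat Nat.Partrec.Code v.head).evaln v.tail.head 0).isSome then 0 else 1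
  have hf : Primrec f := by
    refine Primrec.ite ?_ (.const 0) (.const 1)
    refine Primrec.eq.comp (Primrec.option_isSome.comp ?_) (.const true)
    exact Nat.Partrec.Code.primrec_evaln.comp (.pair (.pair
      (Primrec.vector_head.comp Primrec.vector_tail)
      ((Primrec.ofNat _).comp Primrec.vector_head)) (.const 0))
  obtain ⟨_, A, hA⟩ := CounterAutomaton.exists_realizes_iff_exists (Nat.Primrec'.of_prim hf)
  refine ⟨_, A, fun h => ComputablePred.halting_problem 0 ?_⟩
  have key : ∀ c : Nat.Partrec.Code, (∃ t, A.Realizes (update 0 0 (Encodable.encode c)) t) ↔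
      (c.eval 0).Dom := by
    intro c
    simp only [hA, f, List.Vector.head_cons, List.Vector.tail_cons, Denumerable.ofNat_encode,
      ite_eq_left_iff, one_ne_zero, imp_false, not_not, Part.dom_iff_mem,
      Nat.Partrec.Code.evaln_complete, Option.isSome_iff_exists, Option.mem_def]
    exact exists_comm
  obtain ⟨g, hg, e⟩ := ComputablePred.computable_iff.1 h
  refine ComputablePred.computable_iff.2 ⟨_, hg.comp Computable.encode, ?_⟩
  funext c
  rw [← propext (key c)]
  exact congrFun e (Encodable.encode c)

/-! ### Matching increments with decrements by data values -/

/-- The data values `v` match the decrements of each counter injectively with earlier increments,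
and every increment before a zero test is matched with a decrement before that test. Here `o i`
is the operation at position `i < T`. -/
structure Matching {D : Type*} (T : ℕ) (o : ℕ → Op) (v : ℕ → Option D) : Prop where
  inj : ∀ c i j, i < j → j < T → o i = o j → o i = .inc c ∨ o i = .dec c →
    ∀ d, v i = some d → v j ≠ some d
  dec : ∀ c i, i < T → o i = .dec c → ∃ d, v i = some d ∧ ∃ j < i, o j = .inc c ∧ v j = some d
  zero : ∀ c i z, i < z → z < T → o i = .inc c → o z = .zero c →
    ∃ d, v i = some d ∧ ∃ j, i < j ∧ j < z ∧ o j = .dec c ∧ v j = some d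

open Classical in
/-- The number of occurrences of the operation `e` before position `i`. -/
noncomputable def opCount (o : ℕ → Op) (e : Op) (i : ℕ) : ℕ := Nat.count (fun x => o x = e) i

theorem opCount_zero (o : ℕ → Op) (e : Op) : opCount o e 0 = 0 := by
  classical exact Nat.count_zero _

open Classical in
theorem opCount_succ (o : ℕ → Op) (e : Op) (i : ℕ) :
    opCount o e (i + 1) = opCount o e i + if o i = e then 1 else 0 := Nat.count_succ _ _

theorem opCount_mono (o : ℕ → Op) (e : Op) {i j : ℕ} (h : i ≤ j) :
    opCount o e i ≤ opCount o e j := by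
  classical exact Nat.count_monotone _ h

theorem opCount_lt (o : ℕ → Op) (e : Op) {i j : ℕ} (h : i < j) (hi : o i = e) :
    opCount o e i < opCount o e j :=
  lt_of_lt_of_le (by simp [opCount_succ, hi]) (opCount_mono o e (Nat.succ_le_of_lt h))

theorem exists_opCount_eq (o : ℕ → Op) (e : Op) {i n : ℕ} (h : n < opCount o e i) :
    ∃ j < i, o j = e ∧ opCount o e j = n := by
  induction i with
  | zero => simp [opCount_zero] at h
  | succ i ih =>
    by_cases hi : n < opCount o e i
    · obtain ⟨j, hj, hj'⟩ := ih hi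
      exact ⟨j, by omega, hj'⟩
    · rw [opCount_succ] at h
      split_ifs at h with he
      · exact ⟨i, by omega, he, by omega⟩
      · omega

/-- If the positions of `e` have distinct values, each of which also occurs at a position of `e'`,
then `e` occurs at most as often as `e'`. -/
theorem opCount_le_opCount {D : Type*} {o : ℕ → Op} {v : ℕ → Option D} {e e' : Op} {i : ℕ}
    (h : ∀ x < i, o x = e → ∃ d, v x = some d ∧ ∃ y < i, o y = e' ∧ v y = some d)
    (hinj : ∀ x y, x < y → y < i → o x = e → o y = e → ∀ d, v x = some d → v y ≠ some d) :
    opCount o e i ≤ opCount o e' i := by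
  classical
  rw [opCount, opCount, Nat.count_eq_card_filter_range, Nat.count_eq_card_filter_range]
  choose! d hd f hf using h
  refine Finset.card_le_card_of_injOn f ?_ ?_
  · intro x hx
    simp only [Finset.coe_filter, Finset.mem_range, Set.mem_ofPred_eq] at hx ⊢
    exact ⟨(hf x hx.1 hx.2).1, (hf x hx.1 hx.2).2.1⟩
  · intro x hx y hy hxy
    simp only [Finset.coe_filter, Finset.mem_range, Set.mem_ofPred_eq] at hx hy
    have e : v x = v y := by
      rw [hd x hx.1 hx.2, hd y hy.1 hy.2, ← (hf x hx.1 hx.2).2.2, ← (hf y hy.1 hy.2).2.2, hxy]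
    rcases lt_trichotomy x y with h | h | h
    · exact (hinj x y h hy.1 hx.2 hy.2 _ (hd x hx.1 hx.2) (e ▸ hd x hx.1 hx.2)).elim
    · exact h
    · exact (hinj y x h hx.1 hy.2 hx.2 _ (hd y hy.1 hy.2) (e ▸ hd y hy.1 hy.2)).elim

/-- The operations `o 0, …, o (T - 1)` can be performed starting with all counters zero; `s i` are
the counter values before operation `i`. -/
def Executable (T : ℕ) (o : ℕ → Op) (s : ℕ → ℕ → ℕ) : Prop :=
  s 0 = 0 ∧ ∀ i < T, (o i).Step (s i) (s (i + 1))

theorem Matching.exists_executable {D : Type*} {T : ℕ} {o : ℕ → Op} {v : ℕ → Option D}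
    (h : Matching T o v) : ∃ s, Executable T o s := by
  -- no counter has been decremented more often than incremented, so that the subtraction in the
  -- definition of the counter values below is not truncated
  have le : ∀ i c, i ≤ T → opCount o (.dec c) i ≤ opCount o (.inc c) i := fun i c hi =>
    opCount_le_opCount (v := v)
      (fun x hx hxo => by
        obtain ⟨d, hd, j, hj, hjo⟩ := h.dec c x (by omega) hxo
        exact ⟨d, hd, j, by omega, hjo⟩)
      (fun x y hxy hy hx hy' => h.inj c x y hxy (by omega) (hx.trans hy'.symm) (.inr hx))
  refine ⟨fun i c => opCount o (.inc c) i - opCount o (.dec c) i, ?_, fun i hi => ?_⟩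
  · funext c; simp [opCount_zero]
  · have le₁ := fun c => le i c hi.le
    have le₂ := fun c => le (i + 1) c hi
    simp only [opCount_succ] at le₂ ⊢
    rcases ho : o i with _ | c | c | c
    · funext c; simp
    · funext c'
      have := le₁ c'
      simp only [Function.update_apply, Op.inc.injEq, reduceCtorEq, if_false]
      grind
    · funext c'
      have h₁ := le₁ c'
      have h₂ := le₂ c'
      rw [ho] at h₂
      simp only [Function.update_apply, Op.dec.injEq, reduceCtorEq, if_false] at h₂ ⊢
      grind
    · refine ⟨Nat.sub_eq_zero_of_le (opCount_le_opCount (v := v) ?_ ?_), by funext c; simp⟩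
      · intro x hx hxo
        obtain ⟨d, hd, j, -, hj, hjo⟩ := h.zero c x i hx hi hxo ho
        exact ⟨d, hd, j, hj, hjo⟩
      · exact fun x y hxy hy hx hy' =>
          h.inj c x y hxy (by omega) (hx.trans hy'.symm) (.inl hx)

/-- The `n`-th increment and the `n`-th decrement of a counter get the same value. -/
theorem Executable.exists_matching {D : Type*} [Infinite D] {T : ℕ} {o : ℕ → Op}
    {s : ℕ → ℕ → ℕ} (h : Executable T o s) : ∃ v : ℕ → D, Matching T o fun i => some (v i) := by
  -- the value of a counter is the surplus of its increments over its decrements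
  have bal : ∀ i ≤ T, ∀ c, s i c + opCount o (.dec c) i = opCount o (.inc c) i := by
    intro i
    induction i with
    | zero => simp [h.1, opCount_zero]
    | succ i ih =>
      intro hi c
      have h₁ := ih (by omega) c
      have h₂ := h.2 i (by omega)
      simp only [opCount_succ]
      rcases ho : o i with _ | c' | c' | c' <;> rw [ho] at h₂ <;> simp only [Op.Step] at h₂
      · simp [h₂, h₁]
      · rw [h₂]
        simp only [Function.update_apply, Op.inc.injEq, reduceCtorEq, if_false]
        grind
      · rw [h₂] at h₁
        simp only [Function.update_apply, Op.dec.injEq, reduceCtorEq, if_false] at h₁ ⊢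
        grind
      · simp [h₂.2, h₁]
  let ι := Infinite.natEmbedding D
  let v : ℕ → D := fun i => match o i with
    | .inc c => ι (Nat.pair c (opCount o (.inc c) i))
    | .dec c => ι (Nat.pair c (opCount o (.dec c) i))
    | _ => ι 0
  have v_inc : ∀ {i c}, o i = .inc c → v i = ι (Nat.pair c (opCount o (.inc c) i)) := by
    intro i c hi; simp only [v, hi]
  have v_dec : ∀ {i c}, o i = .dec c → v i = ι (Nat.pair c (opCount o (.dec c) i)) := by
    intro i c hi; simp only [v, hi]
  -- the increment and the decrement with the same number come in this order, because no prefix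
  -- has more decrements than increments
  have order : ∀ {c i j}, i < T → o i = .inc c → j < T → o j = .dec c →
      opCount o (.inc c) i = opCount o (.dec c) j → i < j := by
    intro c i j hi hio hj hjo e
    by_contra hji
    have hij : j < i := by
      refine lt_of_le_of_ne (by omega) fun h => ?_
      rw [h, hio] at hjo
      cases hjo
    have h₁ := bal (j + 1) hj c
    have h₂ := opCount_mono o (.inc c) (Nat.succ_le_of_lt hij)
    have h₃ := opCount_lt o _ (Nat.lt_succ_self j) hjo
    simp only [Nat.succ_eq_add_one] at *
    omega
  refine ⟨v, ?_, ?_, ?_⟩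
  · rintro c i j hij hj e (hi | hi) d hd hd'
    · have hj' := e ▸ hi
      rw [v_inc hi] at hd
      rw [v_inc hj', ← hd] at hd'
      have := opCount_lt o _ hij hi
      simp only [Option.some.injEq, EmbeddingLike.apply_eq_iff_eq, Nat.pair_eq_pair] at hd'
      omega
    · have hj' := e ▸ hi
      rw [v_dec hi] at hd
      rw [v_dec hj', ← hd] at hd'
      have := opCount_lt o _ hij hi
      simp only [Option.some.injEq, EmbeddingLike.apply_eq_iff_eq, Nat.pair_eq_pair] at hd'
      omega
  · intro c i hi ho
    have h₁ := bal (i + 1) hi c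
    have h₂ := opCount_lt o _ (Nat.lt_succ_self i) ho
    have h₃ : opCount o (.inc c) (i + 1) = opCount o (.inc c) i := by simp [opCount_succ, ho]
    obtain ⟨j, hj, hjo, e⟩ := exists_opCount_eq o (.inc c) (i := i) (n := opCount o (.dec c) i)
      (by simp only [Nat.succ_eq_add_one] at *; omega)
    exact ⟨v i, rfl, j, hj, hjo, by simp only [v_inc hjo, v_dec ho, e]⟩
  · intro c i z hiz hz hi hzo
    have h₁ := bal z hz.le c
    have h₂ : s z c = 0 := by
      have := h.2 z hz
      rw [hzo] at this
      exact this.1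
    have h₃ := opCount_lt o _ hiz hi
    obtain ⟨j, hj, hjo, e⟩ := exists_opCount_eq o (.dec c) (i := z) (n := opCount o (.inc c) i)
      (by omega)
    exact ⟨v i, rfl, j, order (by omega) hi (by omega) hjo e.symm, hj, hjo,
      by simp only [v_inc hi, v_dec hjo, e]⟩

/-! ### The formulas -/

/-- A finite system of labels `0, …, halt - 1`, each of which carries an operation; `follows t t'`
says that `t'` may come directly after `t`, where `t' = halt` means that the run may end. -/
structure LabelSystem where
  halt : ℕ
  op : ℕ → Op
  follows : ℕ → ℕ → Prop

/-- The system has an executable run that starts with `n` times the label `0`, followed by the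
label `1`. The run consists of the labels `t 0, …, t (T - 1)`, and `t` is padded with `S.halt`. -/
def LabelSystem.Accepts (S : LabelSystem) (n : ℕ) : Prop :=
  ∃ (T : ℕ) (t : ℕ → ℕ) (s : ℕ → ℕ → ℕ), n < T ∧ (∀ i < n, t i = 0) ∧ t n = 1 ∧
    (∀ i < T, t i < S.halt ∧ S.follows (t i) (t (i + 1))) ∧ (∀ i, T ≤ i → t i = S.halt) ∧
    Executable T (fun i => S.op (t i)) s

namespace PosFormula

variable {k : ℕ} {D : Type*} {w : AttWord k D} {i : ℕ}

/-- The formula that always holds. -/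
def top : PosFormula k := or (prop 0) (neg (prop 0))

/-- Conjunction. -/
def and (φ ψ : PosFormula k) : PosFormula k := neg (or (neg φ) (neg ψ))

/-- The disjunction of a list of formulas. -/
def disj (L : List (PosFormula k)) : PosFormula k := L.foldr or (neg top)

theorem sat_top : Sat w top i := by simp only [top, Sat]; exact em _

theorem sat_and {φ ψ : PosFormula k} : Sat w (and φ ψ) i ↔ Sat w φ i ∧ Sat w ψ i := by
  simp only [and, Sat, not_or, not_not]

theorem sat_disj {L : List (PosFormula k)} : Sat w (disj L) i ↔ ∃ φ ∈ L, Sat w φ i := by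
  induction L with
  | nil => simp [disj, Sat, sat_top]
  | cons φ L ih =>
    have : disj (φ :: L) = or φ (disj L) := rfl
    simp [this, Sat, ih]

open Classical in
/-- Some proposition below `m` that satisfies `P` holds. -/
noncomputable def someProp (m : ℕ) (P : ℕ → Prop) : PosFormula k :=
  disj (((List.range m).filter fun t => P t).map prop)

theorem sat_someProp {m : ℕ} {P : ℕ → Prop} :
    Sat w (someProp m P) i ↔ ∃ t < m, P t ∧ t ∈ w.prop i := by
  simp [someProp, sat_disj, Sat, and_assoc]

/-- Among the propositions below `m`, exactly `t` holds. -/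
noncomputable def onlyProp (m t : ℕ) : PosFormula k := and (prop t) (neg (someProp m (· ≠ t)))

theorem sat_onlyProp {m t : ℕ} :
    Sat w (onlyProp m t) i ↔ t ∈ w.prop i ∧ ∀ t' < m, t' ∈ w.prop i → t' = t := by
  simp only [onlyProp, sat_and, Sat, sat_someProp]
  grind

/-- `φ` holds at some later position that has the same value of `a`. -/
def laterSame (a : Fin k) (φ : PosFormula k) : PosFormula k :=
  cls a 1 (.until (.pos top) (.neg (.or (.neg (.att a)) (.neg (.pos φ)))))

theorem sat_laterSame {a : Fin k} {φ : PosFormula k} : Sat w (laterSame a φ) i ↔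
    ∃ d, w.val i a = some d ∧ ∃ j, i < j ∧ w.IsPos j ∧ w.val j a = some d ∧ Sat w φ j := by
  simp only [laterSame, Sat, ClassFormula.Sat, not_or, not_not]
  constructor
  · rintro ⟨d, hd, j, hj, -, l, hjl, hl, ⟨h₁, h₂⟩, -⟩
    exact ⟨d, hd, l, by omega, hl.1, h₁, h₂⟩
  · rintro ⟨d, hd, l, hil, hl, h₁, h₂⟩
    exact ⟨d, hd, i + 1, by simp, lt_of_le_of_lt (by exact_mod_cast hil) hl, l, hil,
      ⟨hl, a, h₁⟩, ⟨h₁, h₂⟩, fun _ _ _ _ => sat_top⟩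

/-- `φ` holds at some earlier position that has the same value of `a`. -/
def earlierSame (a : Fin k) (φ : PosFormula k) : PosFormula k :=
  cls a (-1) (.since (.pos top) (.neg (.or (.neg (.att a)) (.neg (.pos φ)))))

theorem sat_earlierSame {a : Fin k} {φ : PosFormula k} (hi : w.IsPos i) :
    Sat w (earlierSame a φ) i ↔
      ∃ d, w.val i a = some d ∧ ∃ j, j < i ∧ w.val j a = some d ∧ Sat w φ j := by
  simp only [earlierSame, Sat, ClassFormula.Sat, not_or, not_not]
  constructor
  · rintro ⟨d, hd, j, hj, -, l, hjl, hl, ⟨h₁, h₂⟩, -⟩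
    exact ⟨d, hd, l, by omega, h₁, h₂⟩
  · rintro ⟨d, hd, l, hil, h₁, h₂⟩
    refine ⟨d, hd, i - 1, by omega, lt_of_le_of_lt ?_ hi, l, by omega,
      ⟨lt_trans (by exact_mod_cast hil) hi, a, h₁⟩, ⟨h₁, h₂⟩, fun _ _ _ _ => sat_top⟩
    exact_mod_cast Nat.sub_le i 1

/-- The first `n` positions carry the label `0`, the next one carries the label `1`. -/
def input : ℕ → PosFormula k
  | 0 => prop 1
  | n + 1 => and (prop 0) (next (input n))

theorem sat_input {n : ℕ} (h : (n + i : ℕ) < w.len) : Sat w (input n) i ↔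
    (∀ j < n, 0 ∈ w.prop (i + j)) ∧ 1 ∈ w.prop (i + n) := by
  induction n generalizing i with
  | zero => simp [input, Sat]
  | succ n ih =>
    have h₁ : w.IsPos (i + 1) := lt_of_le_of_lt (by norm_cast; omega) h
    have h₂ : ((n + (i + 1) : ℕ) : ℕ∞) < w.len := by convert h using 2; omega
    simp only [input, sat_and, Sat, ih h₂, h₁, true_and, Nat.forall_lt_succ_left', Nat.add_zero,
      Nat.add_assoc, Nat.add_comm 1, and_assoc]

theorem isPos_of_sat_input {n : ℕ} (hi : w.IsPos i) (h : Sat w (input n) i) : w.IsPos (i + n) := by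
  induction n generalizing i with
  | zero => exact hi
  | succ n ih =>
    simp only [input, sat_and, Sat] at h
    have := ih h.2.1 h.2.2
    rwa [Nat.add_assoc, Nat.add_comm 1] at this

end PosFormula

namespace LabelSystem

open PosFormula

variable {k : ℕ} {D : Type*}

/-- The current position is labelled with the operation `o`. -/
noncomputable def opIs (S : LabelSystem) (o : Op) : PosFormula k :=
  someProp S.halt fun t => S.op t = o

/-- The constraints on data values at a position with the given operation: increments of the same
counter have different values, and so have decrements; a decrement has the value of an earlier
increment; and if an increment is followed by a zero test, then a decrement with its value
precedes the first such test. -/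
noncomputable def dataConstraint (S : LabelSystem) (a : Fin k) : Op → PosFormula k
  | .inc c => and (neg (laterSame a (S.opIs (.inc c))))
      (or (untilAtt a (neg (S.opIs (.zero c))) (S.opIs (.dec c)))
        (neg (.until top (S.opIs (.zero c)))))
  | .dec c => and (earlierSame a (S.opIs (.inc c))) (neg (laterSame a (S.opIs (.dec c))))
  | _ => top

/-- The current position has the label `t` and no other, and the constraints on the successor
and on the data values hold. -/
noncomputable def stepFormula (S : LabelSystem) (a : Fin k) (t : ℕ) : PosFormula k :=
  and (onlyProp (S.halt + 1) t)
    (and (next (someProp (S.halt + 1) (S.follows t))) (S.dataConstraint a (S.op t)))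

/-- The labels of the positions before the first one labelled `S.halt` form a run. -/
noncomputable def runFormula (S : LabelSystem) (a : Fin k) : PosFormula k :=
  .until (disj ((List.range S.halt).map (S.stepFormula a))) (onlyProp (S.halt + 1) S.halt)

/-- The labels form a run on input `n`. -/
noncomputable def formula (S : LabelSystem) (a : Fin k) (n : ℕ) : PosFormula k :=
  and (input n) (S.runFormula a)

theorem sat_opIs {S : LabelSystem} {w : AttWord k D} {o : Op} {i : ℕ} :
    Sat w (S.opIs o) i ↔ ∃ t < S.halt, S.op t = o ∧ t ∈ w.prop i := sat_someProp

/-- Soundness: the labels of any model form a run up to the first halt label, whether or not the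
model is finite and whether or not all values are present. -/
theorem accepts_of_models {S : LabelSystem} (hS : 2 ≤ S.halt) {a : Fin k} {n : ℕ}
    {w : AttWord k D} (h : w.Models (S.formula a n)) : S.Accepts n := by
  obtain ⟨h0, h⟩ := h
  simp only [formula, sat_and, runFormula, Sat, sat_disj, List.mem_map, List.mem_range,
    sat_onlyProp] at h
  obtain ⟨hin, T, -, hT, ⟨h_halt, honly⟩, hstep⟩ := h
  have hpos : ∀ {i}, i ≤ T → w.IsPos i := fun hi => lt_of_le_of_lt (by exact_mod_cast hi) hT
  have hlabel : ∀ i, ∃ t, (T ≤ i → t = S.halt) ∧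
      (i < T → t < S.halt ∧ Sat w (S.stepFormula a t) i) := by
    intro i
    by_cases hi : i < T
    · obtain ⟨_, ⟨t, ht, rfl⟩, h⟩ := hstep i (Nat.zero_le i) hi
      exact ⟨t, by omega, fun _ => ⟨ht, h⟩⟩
    · exact ⟨S.halt, fun _ => rfl, by omega⟩
  choose t ht_halt ht using hlabel
  simp only [stepFormula, sat_and, sat_onlyProp, Sat, sat_someProp] at ht
  have mem_prop : ∀ i ≤ T, ∀ x ≤ S.halt, x ∈ w.prop i → x = t i := by
    intro i hi x hx hxi
    rcases hi.lt_or_eq with hi | rfl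
    · exact (ht i hi).2.1.2 x (by omega) hxi
    · rw [ht_halt i le_rfl]
      exact honly x (by omega) hxi
  have opIs_iff : ∀ i < T, ∀ o, Sat w (S.opIs o) i ↔ S.op (t i) = o := by
    intro i hi o
    rw [sat_opIs]
    constructor
    · rintro ⟨x, hx, rfl, hxi⟩
      rw [mem_prop i hi.le x hx.le hxi]
    · rintro rfl
      exact ⟨t i, (ht i hi).1, rfl, (ht i hi).2.1.1⟩
  have hlen := isPos_of_sat_input h0 hin
  rw [Nat.zero_add] at hlen
  have hin := (sat_input (i := 0) hlen).1 hin
  simp only [Nat.zero_add] at hin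
  have hnT : n < T := by
    by_contra hn
    rcases (not_lt.1 hn).lt_or_eq with hn | rfl
    · have := honly 0 (by omega) (hin.1 T hn)
      omega
    · have := honly 1 (by omega) hin.2
      omega
  have hdata : ∀ i < T, Sat w (S.dataConstraint a (S.op (t i))) i := fun i hi => (ht i hi).2.2.2
  have hmatch : Matching T (fun i => S.op (t i)) fun i => w.val i a := by
    refine ⟨?_, ?_, ?_⟩
    · rintro c i j hij hj e hi d hd hd'
      have h := hdata i (by omega)
      rcases hi with hi | hi <;> rw [hi] at h <;>
        simp only [dataConstraint, sat_and, Sat, sat_laterSame] at h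
      · exact h.1 ⟨d, hd, j, hij, hpos hj.le, hd', (opIs_iff j hj _).2 (e.symm.trans hi)⟩
      · exact h.2 ⟨d, hd, j, hij, hpos hj.le, hd', (opIs_iff j hj _).2 (e.symm.trans hi)⟩
    · intro c i hi ho
      have h := hdata i hi
      rw [ho] at h
      simp only [dataConstraint, sat_and, sat_earlierSame (hpos hi.le)] at h
      obtain ⟨⟨d, hd, j, hj, hjd, hjo⟩, -⟩ := h
      exact ⟨d, hd, j, hj, (opIs_iff j (hj.trans hi) _).1 hjo, hjd⟩
    · intro c i z hiz hz hi hzo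
      have h := hdata i (by omega)
      rw [hi] at h
      simp only [dataConstraint, sat_and, Sat] at h
      rcases h.2 with ⟨d, hd, j, hij, -, ⟨hjd, hjo⟩, hno⟩ | h
      · have hjz : j ≤ z := by
          by_contra hjz
          exact hno z hiz.le (by omega) ((opIs_iff z hz _).2 hzo)
        have hjo := (opIs_iff j (by omega) _).1 hjo
        -- `j` differs from `i` and `z`, since it carries another operation
        refine ⟨d, hd, j, lt_of_le_of_ne hij ?_, lt_of_le_of_ne hjz ?_, hjo, hjd⟩
        · rintro rfl
          simp [hi] at hjo
        · rintro rfl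
          simp [hzo] at hjo
      · exact (h ⟨z, hiz.le, hpos hz.le, (opIs_iff z hz _).2 hzo, fun _ _ _ => sat_top⟩).elim
  obtain ⟨s, hs⟩ := hmatch.exists_executable
  refine ⟨T, t, s, hnT, fun i hi => ?_, ?_, fun i hi => ⟨(ht i hi).1, ?_⟩, ht_halt, hs⟩
  · exact (mem_prop i (by omega) 0 (by omega) (hin.1 i hi)).symm
  · exact (mem_prop n hnT.le 1 (by omega) hin.2).symm
  · obtain ⟨-, x, hx, hf, hxi⟩ := (ht i hi).2.2.1
    rw [← mem_prop (i + 1) hi x (by omega) hxi]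
    exact hf

/-- Completeness: a run yields models without missing values of any length above the run's. After
the run, all positions carry the halt label. -/
theorem exists_models_of_accepts [Infinite D] {S : LabelSystem} (a : Fin k) {n : ℕ}
    (h : S.Accepts n) : ∃ T : ℕ, ∀ ℓ : ℕ∞, T < ℓ →
      ∃ w : AttWord k D, w.len = ℓ ∧ w.Complete ∧ w.Models (S.formula a n) := by
  obtain ⟨T, t, s, hn, h0, h1, hstep, h_halt, hs⟩ := h
  obtain ⟨v, hv⟩ := hs.exists_matching (D := D)
  refine ⟨T, fun ℓ hℓ => ?_⟩
  let w : AttWord k D := ⟨ℓ, fun i => {t i}, fun i _ => some (v i)⟩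
  have hpos : ∀ {i}, i ≤ T → w.IsPos i := fun hi => lt_of_le_of_lt (by exact_mod_cast hi) hℓ
  have opIs_iff : ∀ i o, Sat w (S.opIs o) i ↔ i < T ∧ S.op (t i) = o := by
    intro i o
    simp only [sat_opIs, w, Set.mem_singleton_iff]
    constructor
    · rintro ⟨x, hx, rfl, rfl⟩
      exact ⟨by by_contra hi; exact absurd (h_halt i (by omega)) (by omega), rfl⟩
    · rintro ⟨hi, rfl⟩
      exact ⟨_, (hstep i hi).1, rfl, rfl⟩
  refine ⟨w, rfl, fun i _ _ => rfl, hpos (Nat.zero_le T), ?_⟩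
  have hlen : ((n + 0 : ℕ) : ℕ∞) < w.len := hpos hn.le
  simp only [formula, sat_and, sat_input hlen, runFormula, Sat, sat_disj, List.mem_map,
    List.mem_range, sat_onlyProp]
  refine ⟨⟨fun j hj => ?_, ?_⟩, T, Nat.zero_le T, hpos le_rfl, ⟨?_, ?_⟩, fun i _ hi =>
    ⟨_, ⟨t i, (hstep i hi).1, rfl⟩, ?_⟩⟩
  · simp [w, h0 j hj]
  · simp [w, h1]
  · simp [w, h_halt]
  · simp [w, h_halt]
  simp only [stepFormula, sat_and, sat_onlyProp, Sat, sat_someProp]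
  refine ⟨⟨rfl, fun _ _ h => h⟩, ⟨hpos hi, t (i + 1), ?_, (hstep i hi).2, rfl⟩, ?_⟩
  · by_cases hi' : i + 1 < T
    · exact (hstep _ hi').1.trans (Nat.lt_succ_self _)
    · rw [h_halt _ (by omega)]
      exact Nat.lt_succ_self _
  have later : ∀ c, S.op (t i) = .inc c ∨ S.op (t i) = .dec c →
      ¬ Sat w (laterSame a (S.opIs (S.op (t i)))) i := by
    intro c hc h
    simp only [sat_laterSame, opIs_iff] at h
    obtain ⟨d, hd, j, hij, -, hjd, hj, hjo⟩ := h
    exact hv.inj c i j hij hj hjo.symm hc d hd hjd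
  rcases ho : S.op (t i) with _ | c | c | c
  · exact sat_top
  · simp only [dataConstraint, sat_and, Sat, opIs_iff]
    refine ⟨ho ▸ later c (.inl ho), or_iff_not_imp_right.2 fun hz => ?_⟩
    have hz : ∃ z, i ≤ z ∧ z < T ∧ S.op (t z) = .zero c := by
      obtain ⟨z, hz, -, hz', -⟩ := not_not.1 hz
      exact ⟨z, hz, hz'⟩
    -- the decrement matched before the first zero test comes before all later ones as well
    classical
    obtain ⟨hiz, hzT, hzo⟩ := Nat.find_spec hz
    have hmin := fun m => Nat.find_min hz (m := m)
    set z := Nat.find hz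
    have hiz : i < z := lt_of_le_of_ne hiz fun e => by rw [← e, ho] at hzo; cases hzo
    obtain ⟨d, hd, j, hij, hjz, hjo, hjd⟩ := hv.zero c i z hiz hzT ho hzo
    exact ⟨d, hd, j, hij.le, hpos (by omega), ⟨hjd, by omega, hjo⟩, fun m him hmj hm =>
      hmin m (by omega) ⟨him, hm⟩⟩
  · simp only [dataConstraint, sat_and, Sat, sat_earlierSame (hpos hi.le), opIs_iff]
    refine ⟨?_, ho ▸ later c (.inr ho)⟩
    obtain ⟨d, hd, j, hj, hjo, hjd⟩ := hv.dec c i hi ho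
    exact ⟨d, hd, j, hj, hjd, by omega, hjo⟩
  · exact sat_top

end LabelSystem

/-! ### From counter automata to formulas -/

namespace CounterAutomaton

variable {σ : Type}

/-- Reachability is witnessed by a sequence of configurations, indexed by `ℕ` and constrained only
up to the length of the run. -/
theorem Reach.exists_path {A : CounterAutomaton σ} {c d : σ × (ℕ → ℕ)} (h : A.Reach c d) :
    ∃ (T : ℕ) (e : ℕ → σ × (ℕ → ℕ)), e 0 = c ∧ e T = d ∧ ∀ i < T, A.Step (e i) (e (i + 1)) := by
  induction h using Relation.ReflTransGen.head_induction_on with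
  | refl => exact ⟨0, fun _ => d, rfl, rfl, by simp⟩
  | @head c _ h _ ih =>
    obtain ⟨T, e, rfl, hT, he⟩ := ih
    refine ⟨T + 1, fun i => i.casesOn c e, rfl, hT, fun i hi => ?_⟩
    cases i with
    | zero => exact h
    | succ i => exact he i (by omega)

/-- Label `t` is a transition out of `q`, or the halt label if `q` is final. Labels of transitions
are their indices in the list, shifted by two. -/
def Enters (A : CounterAutomaton σ) (q : σ) (t : ℕ) : Prop :=
  (∃ i x, t = i + 2 ∧ A.trans[i]? = some x ∧ x.1 = q) ∨ t = A.trans.length + 2 ∧ q = A.final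

/-- The label system of an automaton. Label `0` increments counter `0`, and label `1` leads to the
initial state. -/
def labels (A : CounterAutomaton σ) : LabelSystem where
  halt := A.trans.length + 2
  op
    | 0 => .inc 0
    | 1 => .nop
    | i + 2 => (A.trans[i]?).elim .nop fun x => x.2.1
  follows
    | 0, _ => True
    | 1, t => A.Enters A.init t
    | i + 2, t => ∃ x, A.trans[i]? = some x ∧ A.Enters x.2.2 t

theorem realizes_of_accepts {A : CounterAutomaton σ} {n : ℕ} (h : A.labels.Accepts n) :
    ∃ u, A.Realizes (update 0 0 n) u := by
  obtain ⟨T, t, s, hn, h0, h1, hstep, h_halt, hs0, hs⟩ := h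
  have input : ∀ i ≤ n, s i = update (0 : ℕ → ℕ) 0 i := by
    intro i
    induction i with
    | zero => intro _; rw [hs0]; simp
    | succ i ih =>
      intro hi
      have h := hs i (by omega)
      simp only [h0 i hi, labels, Op.Step, ih (by omega)] at h
      simpa using h
  -- after the input phase, the labels are consecutive transitions of the automaton
  have reach : ∀ j, n + 1 + j ≤ T → ∃ q, A.Reach (A.init, update 0 0 n) (q, s (n + 1 + j)) ∧
      A.Enters q (t (n + 1 + j)) := by
    intro j
    induction j with
    | zero =>
      intro _
      have h := hs n hn
      have hf := (hstep n hn).2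
      simp only [h1, labels, Op.Step, input n le_rfl] at h hf
      exact ⟨A.init, by rw [Nat.add_zero, h]; exact .refl, hf⟩
    | succ j ih =>
      intro hj
      obtain ⟨q, hq, hqt⟩ := ih (by omega)
      have h := hs (n + 1 + j) (by omega)
      obtain ⟨hlt, hf⟩ := hstep (n + 1 + j) (by omega)
      rcases hqt with ⟨i, x, hi, hx, rfl⟩ | ⟨hi, -⟩
      · simp only [hi, labels, hx, Option.elim_some, Option.some.injEq, exists_eq_left'] at h hf
        exact ⟨x.2.2, hq.tail ⟨x.2.1, List.mem_of_getElem? hx, h⟩, hf⟩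
      · exact absurd hlt (by simp [hi, labels])
  obtain ⟨q, hq, hqt⟩ := reach (T - (n + 1)) (by omega)
  rw [show n + 1 + (T - (n + 1)) = T by omega] at hq hqt
  rcases hqt with ⟨i, x, hi, hx, -⟩ | ⟨-, rfl⟩
  · have : i < A.trans.length := (List.getElem?_eq_some_iff.1 hx).1
    have := (h_halt T le_rfl).symm.trans hi
    simp only [labels] at this
    omega
  · exact ⟨_, hq⟩

theorem accepts_of_realizes {A : CounterAutomaton σ} {n : ℕ} {u : ℕ → ℕ}
    (h : A.Realizes (update 0 0 n) u) : A.labels.Accepts n := by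
  obtain ⟨T, e, he0, heT, he⟩ := h.exists_path
  have hidx : ∀ j, ∃ i : ℕ, j < T → ∃ x : σ × Op × σ, A.trans[i]? = some x ∧ x.1 = (e j).1 ∧
      x.2.2 = (e (j + 1)).1 ∧ x.2.1.Step (e j).2 (e (j + 1)).2 := by
    intro j
    by_cases hj : j < T
    · obtain ⟨o, hm, ho⟩ := he j hj
      obtain ⟨i, hi⟩ := List.mem_iff_getElem?.1 hm
      exact ⟨i, fun _ => ⟨_, hi, rfl, rfl, ho⟩⟩
    · exact ⟨0, fun h => (hj h).elim⟩
  choose idx hidx using hidx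
  -- `n` labels `0`, the label `1`, the transitions of the run, and then the halt label
  let t : ℕ → ℕ := fun i => if i < n then 0 else if i = n then 1 else
    if i < n + 1 + T then idx (i - (n + 1)) + 2 else A.trans.length + 2
  let s : ℕ → ℕ → ℕ := fun i => if i ≤ n then update 0 0 i else (e (i - (n + 1))).2
  have t_zero : ∀ i < n, t i = 0 := fun i hi => by simp [t, hi]
  have t_one : t n = 1 := by simp [t]
  have t_idx : ∀ j < T, t (n + 1 + j) = idx j + 2 := fun j hj => by
    have h₁ : ¬ n + 1 + j < n := by omega
    have h₂ : n + 1 + j ≠ n := by omega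
    simp [t, h₁, h₂, hj]
  have t_halt : ∀ i, n + 1 + T ≤ i → t i = A.trans.length + 2 := fun i hi => by
    have h₁ : ¬ i < n := by omega
    have h₂ : i ≠ n := by omega
    have h₃ : ¬ i < n + 1 + T := by omega
    simp [t, h₁, h₂, h₃]
  have s_input : ∀ i ≤ n, s i = update (0 : ℕ → ℕ) 0 i := fun i hi => by simp [s, hi]
  have s_path : ∀ j, s (n + 1 + j) = (e j).2 := fun j => by
    have h₁ : ¬ n + 1 + j ≤ n := by omega
    simp [s, h₁]
  have enters : ∀ j ≤ T, A.Enters (e j).1 (t (n + 1 + j)) := by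
    intro j hj
    rcases hj.lt_or_eq with hj | rfl
    · obtain ⟨x, hx, hx', -⟩ := hidx j hj
      exact .inl ⟨idx j, x, t_idx j hj, hx, hx'⟩
    · exact .inr ⟨t_halt _ le_rfl, by rw [heT]⟩
  refine ⟨n + 1 + T, t, s, by omega, t_zero, t_one, fun i hi => ?_, t_halt, ?_, fun i hi => ?_⟩
  · rcases lt_trichotomy i n with h | rfl | h
    · rw [t_zero i h]
      exact ⟨by simp [labels], trivial⟩
    · rw [t_one]
      refine ⟨by simp [labels], ?_⟩
      simpa [labels, he0] using enters 0 (Nat.zero_le T)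
    · obtain ⟨j, rfl⟩ := Nat.exists_eq_add_of_le (Nat.succ_le_of_lt h)
      have hj : j < T := by simp only [Nat.succ_eq_add_one] at hi; omega
      obtain ⟨x, hx, -, hx', -⟩ := hidx j hj
      simp only [Nat.succ_eq_add_one, t_idx j hj]
      refine ⟨?_, x, hx, ?_⟩
      · have := (List.getElem?_eq_some_iff.1 hx).1
        simp only [labels]
        omega
      · rw [hx']
        exact enters (j + 1) hj
  · rw [s_input 0 (Nat.zero_le n)]
    simp
  · rcases lt_trichotomy i n with h | rfl | h
    · simp only [t_zero i h, labels, Op.Step, s_input i h.le, s_input (i + 1) h]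
      simp
    · simp only [t_one, labels, Op.Step, s_input i le_rfl]
      have := s_path 0
      rw [Nat.add_zero] at this
      rw [this, he0]
    · obtain ⟨j, rfl⟩ := Nat.exists_eq_add_of_le (Nat.succ_le_of_lt h)
      have hj : j < T := by simp only [Nat.succ_eq_add_one] at hi; omega
      obtain ⟨x, hx, -, -, hx'⟩ := hidx j hj
      simp only [Nat.succ_eq_add_one, t_idx j hj, labels, hx, Option.elim_some, s_path,
        Nat.add_assoc (n + 1) j 1]
      exact hx'

end CounterAutomaton

/-! ### Undecidability -/

theorem computable_code_formula {k : ℕ} (S : LabelSystem) (a : Fin k) :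
    Computable fun n => (S.formula a n).code := by
  have pair : ∀ {g h : ℕ → ℕ}, Primrec g → Primrec h → Primrec fun n => Nat.pair (g n) (h n) :=
    fun hg hh => Primrec₂.natPair.comp hg hh
  have hinput : Primrec fun n => (PosFormula.input n : PosFormula k).code := by
    refine (Primrec.nat_rec₁ (f := fun _ c => Nat.pair 1 (Nat.pair 2 (Nat.pair
      (Nat.pair 1 (Nat.pair 0 0)) (Nat.pair 1 (Nat.pair 3 c))))) (Nat.pair 0 1) ?_).of_eq ?_
    · have c : ∀ m : ℕ, Primrec fun _ : ℕ × ℕ => m := fun m => .const m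
      exact Primrec₂.natPair.comp (c _) (Primrec₂.natPair.comp (c _) (Primrec₂.natPair.comp (c _)
        (Primrec₂.natPair.comp (c _) (Primrec₂.natPair.comp (c _) .snd))))
    · intro n
      induction n with
      | zero => simp [PosFormula.input, PosFormula.code]
      | succ n ih => simp [PosFormula.input, PosFormula.and, PosFormula.code, ← ih]
  have : Primrec fun n => (S.formula a n).code := by
    simp only [LabelSystem.formula, PosFormula.and, PosFormula.code]
    exact pair (.const _) (pair (.const _) (pair (pair (.const _) hinput) (.const _)))
  exact this.to_comp

theorem undecidable_of_reduction {α : Type*} {code : α → ℕ} {P : α → Prop} {p : ℕ → Prop}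
    (hp : ¬ ComputablePred p) (φ : ℕ → α) (hφ : Computable fun n => code (φ n))
    (h : ∀ n, P (φ n) ↔ p n) : Undecidable code P := by
  rintro ⟨f, hf, hfP⟩
  refine hp (ComputablePred.computable_iff.2 ⟨fun n => f (code (φ n)), hf.comp hφ, ?_⟩)
  funext n
  rw [hfP, h]

/-- There is an undecidable set of numbers that reduces to each of the satisfiability problems. -/
theorem exists_reduction (D : Type*) [Infinite D] : ∃ p : ℕ → Prop, ¬ ComputablePred p ∧
    ∀ k : ℕ, 1 ≤ k → ∃ φ : ℕ → PosFormula k, Computable (fun n => (φ n).code) ∧ ∀ n,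
      (FinSatisfiable D (φ n) ↔ p n) ∧ (InfSatisfiable D (φ n) ↔ p n) ∧
      (FinSatisfiableComplete D (φ n) ↔ p n) ∧ (InfSatisfiableComplete D (φ n) ↔ p n) := by
  obtain ⟨σ, A, hA⟩ := exists_counterAutomaton_undecidable
  refine ⟨_, hA, fun k hk => ⟨A.labels.formula ⟨0, hk⟩, computable_code_formula _ _, fun n => ?_⟩⟩
  have sound : ∀ w : AttWord k D, w.Models (A.labels.formula ⟨0, hk⟩ n) →
      ∃ t, A.Realizes (update 0 0 n) t := fun w hw =>
    CounterAutomaton.realizes_of_accepts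
      (LabelSystem.accepts_of_models (by simp [CounterAutomaton.labels]) hw)
  have complete : (∃ t, A.Realizes (update 0 0 n) t) → ∃ T : ℕ, ∀ ℓ : ℕ∞, T < ℓ →
      ∃ w : AttWord k D, w.len = ℓ ∧ w.Complete ∧ w.Models (A.labels.formula ⟨0, hk⟩ n) := by
    rintro ⟨t, ht⟩
    exact LabelSystem.exists_models_of_accepts _ (CounterAutomaton.accepts_of_realizes ht)
  have fin : (∃ t, A.Realizes (update 0 0 n) t) →
      FinSatisfiableComplete D (A.labels.formula ⟨0, hk⟩ n) := by
    intro h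
    obtain ⟨T, hT⟩ := complete h
    obtain ⟨w, hw, hw'⟩ := hT ((T + 1 : ℕ) : ℕ∞) (by exact_mod_cast Nat.lt_succ_self T)
    exact ⟨w, by rw [hw]; exact ENat.natCast_ne_top _, hw'⟩
  have inf : (∃ t, A.Realizes (update 0 0 n) t) →
      InfSatisfiableComplete D (A.labels.formula ⟨0, hk⟩ n) := by
    intro h
    obtain ⟨T, hT⟩ := complete h
    exact hT ⊤ (ENat.natCast_lt_top T)
  refine ⟨⟨fun ⟨w, _, hw⟩ => sound w hw, fun h => ?_⟩, ⟨fun ⟨w, _, hw⟩ => sound w hw, fun h => ?_⟩,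
    ⟨fun ⟨w, _, _, hw⟩ => sound w hw, fin⟩, ⟨fun ⟨w, _, _, hw⟩ => sound w hw, inf⟩⟩
  · obtain ⟨w, hw, -, hw'⟩ := fin h
    exact ⟨w, hw, hw'⟩
  · obtain ⟨w, hw, -, hw'⟩ := inf h
    exact ⟨w, hw, hw'⟩

end DataLTL

theorem mainTheorem1 (D : Type*) [Infinite D] :
    -- attributed words, the finite set of attributes being part of the input
    (DataLTL.Undecidable DataLTL.codeAny (fun x => DataLTL.FinSatisfiable D x.2) ∧
      DataLTL.Undecidable DataLTL.codeAny (fun x => DataLTL.InfSatisfiable D x.2)) ∧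
    -- words with a fixed number `k ≥ 1` of attributes, in particular `k = 1`
    ∀ k : ℕ, 1 ≤ k →
      (DataLTL.Undecidable (DataLTL.PosFormula.code (k := k)) (DataLTL.FinSatisfiable D) ∧
        DataLTL.Undecidable (DataLTL.PosFormula.code (k := k)) (DataLTL.InfSatisfiable D)) ∧
      -- the same for words in which every attribute has a value at every position
      (DataLTL.Undecidable (DataLTL.PosFormula.code (k := k))
          (DataLTL.FinSatisfiableComplete D) ∧
        DataLTL.Undecidable (DataLTL.PosFormula.code (k := k))
          (DataLTL.InfSatisfiableComplete D)) := by

  obtain ⟨p, hp, h⟩ := DataLTL.exists_reduction D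
  have any : ∀ φ : ℕ → DataLTL.PosFormula 1, Computable (fun n => (φ n).code) →
      Computable fun n => DataLTL.codeAny ⟨1, φ n⟩ := fun φ hφ =>
    (Primrec₂.natPair.comp (.const 1) .id).to_comp.comp hφ
  refine ⟨?_, fun k hk => ?_⟩
  · obtain ⟨φ, hφ, h⟩ := h 1 le_rfl
    exact ⟨DataLTL.undecidable_of_reduction hp (fun n => ⟨1, φ n⟩) (any φ hφ) fun n => (h n).1,
      DataLTL.undecidable_of_reduction hp (fun n => ⟨1, φ n⟩) (any φ hφ) fun n => (h n).2.1⟩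
  · obtain ⟨φ, hφ, h⟩ := h k hk
    exact ⟨⟨DataLTL.undecidable_of_reduction hp φ hφ fun n => (h n).1,
      DataLTL.undecidable_of_reduction hp φ hφ fun n => (h n).2.1⟩,
      DataLTL.undecidable_of_reduction hp φ hφ fun n => (h n).2.2.1,
      DataLTL.undecidable_of_reduction hp φ hφ fun n => (h n).2.2.2⟩
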